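/- Let $N$ be a positive even integer, $k\in\mathbb Z$, and let $\tau$ be a point of the upper half plane. Put $\zeta_N=e^{2\pi i/N}$, $q=e^{2\pi i\tau}$ and $q^{1/2}=e^{\pi i\tau}$. For a lattice $L\subset\mathbb C$ and $u\in N^{-1}L$ let $$\Phi(L,u,s)=\sum_{\omega\ne 0,\ \omega/N\equiv u \bmod L}\omega^{-1}|\omega|^{-s}\qquad(\operatorname{Re}s>1),$$ let $G(L,u)=\Phi(L,u,0)$ by analytic continuation in $s$, and for $a,b\in\mathbb Z$ let $$G_{a,b}(\tau)=G\bigl(\mathbb Z\tau+\mathbb Z,\ (a\tau+b)/N\bigr),$$ which depends only on $a,b$ modulo $N$. Let $$h_k(\tau)=\sum_{n=1}^{\infty}\Bigl(-\sum_{m\mid n,\ m>0,\ m\text{ odd}}\bigl(\zeta_N^{kn/m}-\zeta_N^{-kn/m}\bigr)\Bigr)q^{n/2}.$$ **Proposition 3.5.** For $L=\mathbb Z\tau+\mathbb Z$ and all $a,b\in\mathbb Z$ the series $\Phi(L,(a\tau+b)/N,s)$ converges for $\operatorname{Re}s>1$ and continues holomorphically to a half plane $\operatorname{Re}s>\sigma$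 with $\sigma<0$, so that $G_{a,b}(\tau)$ is defined; the series $h_k(\tau)$ converges absolutely; and $$\frac1{2\pi i}\sum_{a,b \bmod N}\zeta_N^{ka}(-1)^b\,G_{a,b}(\tau)=h_k(\tau).$$ Moreover, if $q$ is real and positive, then $h_k(\tau)=\frac1i D_{0,q}(\zeta_N^kq^{1/2})$, where $D_{0,q}(z)=\sum_{j\in\mathbb Z}D_0(zq^j)$ (a convergent sum at $z=\zeta_N^kq^{1/2}$), $D_0(z)=\operatorname{Im}(z/(1-z))$ for $z\ne1$, and $D_0(1)=0$. -/

import Mathlib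

open scoped UpperHalfPlane

namespace HeckeEisenstein

noncomputable section

/-- The nonzero complex numbers `ω` with `ω / N ≡ u mod L`. -/
def summationSet (N : ℕ) (L : Submodule ℤ ℂ) (u : ℂ) : Set ℂ :=
  {ω : ℂ | ω ≠ 0 ∧ ω / N - u ∈ L}

/-- `Φ` has a continuation `F` past `s = 0`: the function `F` is holomorphic on the half-plane
`Re s > σ`, and for `Re s > 1` it is the sum of the (convergent) series
`Φ(L, u, s) = ∑' ω⁻¹ |ω|⁻ˢ` over all nonzero `ω` with `ω / N ≡ u mod L`. -/
def IsContinuation (N : ℕ) (L : Submodule ℤ ℂ) (u : ℂ) (σ : ℝ) (F : ℂ → ℂ) : Prop :=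
  DifferentiableOn ℂ F {s : ℂ | σ < s.re} ∧
    ∀ s : ℂ, 1 < s.re →
      HasSum (fun ω : summationSet N L u =>
        (ω : ℂ)⁻¹ * ((‖(ω : ℂ)‖ : ℝ) : ℂ) ^ (-s)) (F s)

/-- `Φ(L, u, ·)` has a holomorphic continuation to a half-plane `Re s > σ` with `σ < 0`. -/
def HasContinuation (N : ℕ) (L : Submodule ℤ ℂ) (u : ℂ) : Prop :=
  ∃ F : ℂ → ℂ, ∃ σ : ℝ, σ < 0 ∧ IsContinuation N L u σ F

open Classical in
/-- Hecke's Eisenstein series of weight one, `G(L, u) = Φ(L, u, 0)` by analytic continuation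
(with the value `0` if there were no continuation). -/
def G (N : ℕ) (L : Submodule ℤ ℂ) (u : ℂ) : ℂ :=
  if h : HasContinuation N L u then h.choose 0 else 0

/-- The value `G(L, u)` does not depend on the choice of the continuation. -/
theorem G_eq_of_isContinuation {N : ℕ} {L : Submodule ℤ ℂ} {u : ℂ} {σ : ℝ} {F : ℂ → ℂ}
    (hσ : σ < 0) (hF : IsContinuation N L u σ F) : G N L u = F 0 := by
  have h : HasContinuation N L u := ⟨F, σ, hσ, hF⟩
  obtain ⟨σ', hσ', hF'⟩ := h.choose_spec
  rw [G, dif_pos h]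
  have hopen : IsOpen {s : ℂ | max σ σ' < s.re} := isOpen_lt continuous_const Complex.continuous_re
  have hpre : IsPreconnected {s : ℂ | max σ σ' < s.re} :=
    (convex_halfSpace_re_gt (max σ σ')).isPreconnected
  have h1 : AnalyticOnNhd ℂ F {s : ℂ | max σ σ' < s.re} :=
    (hF.1.mono fun s (hs : max σ σ' < s.re) => show σ < s.re from
      lt_of_le_of_lt (le_max_left _ _) hs).analyticOnNhd hopen
  have h2 : AnalyticOnNhd ℂ h.choose {s : ℂ | max σ σ' < s.re} :=
    (hF'.1.mono fun s (hs : max σ σ' < s.re) => show σ' < s.re from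
      lt_of_le_of_lt (le_max_right _ _) hs).analyticOnNhd hopen
  have hm : max σ σ' < 0 := max_lt hσ hσ'
  have hev : h.choose =ᶠ[nhds (2 : ℂ)] F := by
    have ho : {s : ℂ | 1 < s.re} ∈ nhds (2 : ℂ) :=
      (isOpen_lt continuous_const Complex.continuous_re).mem_nhds (by simp)
    filter_upwards [ho] with s hs
    exact (hF'.2 s hs).unique (hF.2 s hs)
  refine h2.eqOn_of_preconnected_of_eventuallyEq h1 hpre (z₀ := 2) ?_ hev ?_
  · change max σ σ' < (2 : ℂ).re
    simp only [Complex.re_ofNat]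
    linarith
  · change max σ σ' < (0 : ℂ).re
    simpa using hm

/-- The lattice `ℤ τ + ℤ`. -/
def lattice (τ : ℍ) : Submodule ℤ ℂ := Submodule.span ℤ {(τ : ℂ), 1}

/-- The point `(a τ + b) / N` of `N⁻¹ (ℤ τ + ℤ)`. -/
def torsionPoint (N : ℕ) (a b : ℤ) (τ : ℍ) : ℂ := (a * (τ : ℂ) + b) / N

/-- `G_{a,b}(τ) = G(ℤ τ + ℤ, (a τ + b) / N)`. -/
def Gab (N : ℕ) (a b : ℤ) (τ : ℍ) : ℂ := G N (lattice τ) (torsionPoint N a b τ)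

/-- `G(L, u)` depends only on `u` modulo `L`. -/
theorem G_congr {N : ℕ} {L : Submodule ℤ ℂ} {u v : ℂ} (h : u - v ∈ L) : G N L u = G N L v := by
  have hset : summationSet N L u = summationSet N L v := by
    ext ω
    have e : ω / N - v = (ω / N - u) + (u - v) := by ring
    simp only [summationSet, Set.mem_ofPred_eq]
    rw [e, L.add_mem_iff_left h]
  have hc : ∀ σ F, IsContinuation N L u σ F = IsContinuation N L v σ F := by
    intro σ F
    unfold IsContinuation
    rw [hset]
  have hh : HasContinuation N L u = HasContinuation N L v := by
    simp only [HasContinuation, hc]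
  by_cases hu : HasContinuation N L u
  · obtain ⟨F, σ, hσ, hF⟩ := hu
    rw [G_eq_of_isContinuation hσ hF, G_eq_of_isContinuation hσ (hc σ F ▸ hF)]
  · rw [G, G, dif_neg hu, dif_neg (hh ▸ hu)]

/-- `G_{a,b}` depends only on `a` and `b` modulo `N`, so sums over residues make sense. -/
theorem Gab_congr {N : ℕ} (hN : 0 < N) {a a' b b' : ℤ} (ha : a ≡ a' [ZMOD N])
    (hb : b ≡ b' [ZMOD N]) (τ : ℍ) : Gab N a b τ = Gab N a' b' τ := by
  obtain ⟨c, hc⟩ := ha.symm.dvd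
  obtain ⟨d, hd⟩ := hb.symm.dvd
  apply G_congr
  rw [lattice, Submodule.mem_span_pair]
  refine ⟨c, d, ?_⟩
  have hN' : (N : ℂ) ≠ 0 := by exact_mod_cast hN.ne'
  have hc' : (a : ℂ) - a' = N * c := by exact_mod_cast hc
  have hd' : (b : ℂ) - b' = N * d := by exact_mod_cast hd
  simp only [torsionPoint, zsmul_eq_mul]
  field_simp
  linear_combination -(τ : ℂ) * hc' - hd'

/-- The root of unity `ζ_N = exp (2 π i / N)`. -/
def zetaN (N : ℕ) : ℂ := Complex.exp (2 * Real.pi * Complex.I / N)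

/-- The coefficient of `q^{n/2}` in `h_k`, for `n > 0`. -/
def hCoeff (N : ℕ) (k : ℤ) (n : ℕ) : ℂ :=
  -∑ m ∈ n.divisors with Odd m,
    (zetaN N ^ (k * ((n / m : ℕ) : ℤ)) - zetaN N ^ (-(k * ((n / m : ℕ) : ℤ))))

/-- `q = exp (2 π i τ)`. -/
def q (τ : ℍ) : ℂ := Complex.exp (2 * Real.pi * Complex.I * τ)

/-- `q^{1/2} = exp (π i τ)`. -/
def qHalf (τ : ℍ) : ℂ := Complex.exp (Real.pi * Complex.I * τ)

/-- The `n`-th term of the series `h_k`, where `n ≥ 1`. -/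
def hTerm (N : ℕ) (k : ℤ) (τ : ℍ) (n : ℕ+) : ℂ := hCoeff N k n * qHalf τ ^ (n : ℕ)

/-- `h_k(τ)`, a power series in `q^{1/2}` without constant term. -/
def h (N : ℕ) (k : ℤ) (τ : ℍ) : ℂ := ∑' n : ℕ+, hTerm N k τ n

/-- `D_0(z) = Im (z / (1 - z))`, and `D_0(1) = 0`. -/
def D0 (z : ℂ) : ℝ := (z / (1 - z)).im

/-- The average `D_{0,q}(z) = ∑_{j ∈ ℤ} D_0(z q^j)`. -/
def D0q (q z : ℂ) : ℝ := ∑' j : ℤ, D0 (z * q ^ j)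

end

end HeckeEisenstein

namespace HeckeEisenstein

open Complex Filter Topology

noncomputable section

/-! The terms of Φ have size |ω|^(-1 - Re s), but their second differences in a fixed direction are
O(|ω|^(-3 - Re s)), because the linear Taylor term is odd in the displacement. So a series of second
differences with bounded coefficients is holomorphic on Re s > -1 (`tsum_mul_secondDiff`), and for
Re s > 1 the differences can be moved onto the coefficients (`tsum_mul_secondDiff_eq`).

Continuation: let S(u) be the sum over the class u modulo N. Modulo functions that continue to Re s
> -1, the sequence n ↦ S(n e) has zero second differences, and S(0) = 0 by oddness; hence S(n e) ≡ n
S(e), and n = N gives N S(e) ≡ 0 (`continues_classSum`).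

Identity: for even N the character ζ_N^{kc} (-1)^d depends only on residues and changes sign under d
↦ d ± 1, so differencing in the direction 1 multiplies the twisted sum by -4. At s = 0 this leaves
an absolutely convergent series, which is summed by rows. For c > 0 the cotangent expansion gives
8πi y / (1 - y²) with y = q^{c/2}, and the rows c and -c are opposite before twisting. Expanding in
odd powers y^m and collecting cm = n gives -h_k.

Real q: summing the same double series over c first produces 2i D_0(ζ_N^k q^{m/2}) for odd m, and
the symmetry D_0(1 / w̄) = D_0(w) unfolds this into the sum over all integers j. -/

/-! ### Taylor expansion of Hecke's summand. -/

/-- The summand `w⁻¹ |w|⁻ˢ` of Hecke's series; it vanishes at `w = 0`. -/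
def heckeTerm (w s : ℂ) : ℂ := w⁻¹ * ((‖w‖ : ℝ) : ℂ) ^ (-s)

@[simp]
lemma heckeTerm_zero_left (s : ℂ) : heckeTerm 0 s = 0 := by simp [heckeTerm]

@[simp]
lemma heckeTerm_zero_right (w : ℂ) : heckeTerm w 0 = w⁻¹ := by simp [heckeTerm]

lemma heckeTerm_neg (w s : ℂ) : heckeTerm (-w) s = -heckeTerm w s := by
  simp [heckeTerm, inv_neg]

lemma heckeTerm_mul (w z s : ℂ) : heckeTerm (w * z) s = heckeTerm w s * heckeTerm z s := by
  simp only [heckeTerm, norm_mul, ofReal_mul, mul_inv]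
  rw [mul_cpow_ofReal_nonneg (norm_nonneg _) (norm_nonneg _)]
  ring

lemma norm_heckeTerm {w : ℂ} (hw : w ≠ 0) (s : ℂ) : ‖heckeTerm w s‖ = ‖w‖ ^ (-1 - s.re) := by
  have h : 0 < ‖w‖ := norm_pos_iff.mpr hw
  rw [heckeTerm, norm_mul, norm_cpow_eq_rpow_re_of_pos h, norm_inv, sub_eq_add_neg,
    Real.rpow_add h, Real.rpow_neg_one, neg_re]

lemma differentiable_heckeTerm (w : ℂ) : Differentiable ℂ (heckeTerm w) := by
  rcases eq_or_ne w 0 with rfl | hw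
  · simp [funext heckeTerm_zero_left]
  · have h : ((‖w‖ : ℝ) : ℂ) ≠ 0 := by simpa using hw
    intro s
    exact ((differentiableAt_id.neg).const_cpow (Or.inl h)).const_mul _

/-- Since log |1 + z| = Re log (1 + z), the summand is the exponential of a real-linear function of
the logarithm. -/
lemma heckeTerm_one_add {z : ℂ} (hz : ‖z‖ < 1) (s : ℂ) :
    heckeTerm (1 + z) s = exp (-(log (1 + z) + s * ((log (1 + z)).re : ℂ))) := by
  have h : 1 + z ≠ 0 := by
    intro h
    have : z = -1 := by linear_combination h
    simp [this] at hz
  have hp : 0 < ‖1 + z‖ := norm_pos_iff.mpr h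
  rw [heckeTerm, cpow_def_of_ne_zero (by simpa using h), neg_add, exp_add, exp_neg, exp_log h,
    log_re, ofReal_log hp.le]
  congr 2
  ring

/-- First-order Taylor estimate, uniform for bounded s. The linear term is only real-linear in z,
but it is odd, which is all that second differences need. -/
lemma norm_heckeTerm_one_add_sub_le {z s : ℂ} {R : ℝ} (hz : ‖z‖ ≤ 1 / 2) (hs : ‖s‖ ≤ R) :
    ‖heckeTerm (1 + z) s - 1 + (z + s * (z.re : ℂ))‖ ≤
      ((1 + R) ^ 2 * (9 / 4) * Real.exp (1 + R) + (1 + R)) * ‖z‖ ^ 2 := by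
  have hR : 0 ≤ R := (norm_nonneg _).trans hs
  have h0 := norm_nonneg z
  set l := log (1 + z) with hl
  have hlz : ‖l - z‖ ≤ ‖z‖ ^ 2 := by
    refine (norm_log_one_add_sub_self_le (by linarith)).trans ?_
    have : (1 - ‖z‖)⁻¹ ≤ 2 := by
      rw [inv_le_comm₀ (by linarith) (by norm_num)]
      linarith
    nlinarith [sq_nonneg ‖z‖]
  have key (x : ℂ) : ‖x + s * (x.re : ℂ)‖ ≤ (1 + R) * ‖x‖ := by
    have : ‖s * (x.re : ℂ)‖ ≤ R * ‖x‖ := by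
      rw [norm_mul, norm_real, Real.norm_eq_abs]
      exact mul_le_mul hs (abs_re_le_norm x) (abs_nonneg _) hR
    linarith [norm_add_le x (s * (x.re : ℂ))]
  -- The factor 3/2 is 1 + ‖z‖ at the largest allowed ‖z‖; its square is the 9/4 in the constant.
  have hlb : ‖l‖ ≤ 3 / 2 * ‖z‖ := by
    have : ‖l‖ ≤ ‖l - z‖ + ‖z‖ := by simpa using norm_add_le (l - z) z
    nlinarith
  set A := -(l + s * (l.re : ℂ)) with hA
  have hAn : ‖A‖ ≤ (1 + R) * (3 / 2 * ‖z‖) := by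
    rw [hA, norm_neg]
    exact (key l).trans (mul_le_mul_of_nonneg_left hlb (by linarith))
  have hE : ‖exp A - 1 - A‖ ≤ ‖A‖ ^ 2 * Real.exp ‖A‖ := by
    simpa [Finset.sum_range_succ, sub_sub] using norm_exp_sub_sum_le_norm_mul_exp A 2
  have hE' : ‖A‖ ^ 2 * Real.exp ‖A‖ ≤ ((1 + R) * (3 / 2 * ‖z‖)) ^ 2 * Real.exp (1 + R) := by
    gcongr
    refine hAn.trans ?_
    nlinarith
  have hd : ‖(l - z) + s * ((l - z).re : ℂ)‖ ≤ (1 + R) * ‖z‖ ^ 2 :=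
    (key _).trans (mul_le_mul_of_nonneg_left hlz (by linarith))
  rw [heckeTerm_one_add (by linarith), ← hl, ← hA]
  have e : exp A - 1 + (z + s * (z.re : ℂ)) =
      (exp A - 1 - A) - ((l - z) + s * ((l - z).re : ℂ)) := by
    rw [hA, sub_re, ofReal_sub]
    ring
  rw [e]
  refine (norm_sub_le _ _).trans ?_
  linarith

/-- The second difference of `heckeTerm` in the direction `e`. -/
def secondDiff (w e s : ℂ) : ℂ := heckeTerm (w + e) s + heckeTerm (w - e) s - 2 * heckeTerm w s

lemma differentiable_secondDiff (w e : ℂ) : Differentiable ℂ (secondDiff w e) :=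
  ((differentiable_heckeTerm _).add (differentiable_heckeTerm _)).sub
    ((differentiable_heckeTerm _).const_mul 2)

lemma exists_norm_secondDiff_le (e : ℂ) (R : ℝ) :
    ∃ C, ∀ w s : ℂ, w ≠ 0 → 2 * ‖e‖ ≤ ‖w‖ → ‖s‖ ≤ R →
      ‖secondDiff w e s‖ ≤ C * ‖w‖ ^ (-3 - s.re) := by
  set K := (1 + R) ^ 2 * (9 / 4) * Real.exp (1 + R) + (1 + R) with hK
  refine ⟨2 * K * ‖e‖ ^ 2, fun w s hw hwe hs ↦ ?_⟩
  have hwp : 0 < ‖w‖ := norm_pos_iff.mpr hw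
  set z := e / w with hz
  have hzn : ‖z‖ ≤ 1 / 2 := by
    rw [hz, norm_div, div_le_iff₀ hwp]
    linarith
  have e1 : w + e = w * (1 + z) := by rw [hz]; field_simp
  have e2 : w - e = w * (1 + -z) := by rw [hz]; field_simp; ring
  have h1 := norm_heckeTerm_one_add_sub_le hzn hs
  have h2 := norm_heckeTerm_one_add_sub_le (z := -z) (by simpa using hzn) hs
  rw [norm_neg] at h2
  -- By multiplicativity the factor at w comes out, and the linear terms at z and -z cancel.
  have e3 : secondDiff w e s = heckeTerm w s *
      ((heckeTerm (1 + z) s - 1 + (z + s * (z.re : ℂ))) +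
        (heckeTerm (1 + -z) s - 1 + (-z + s * ((-z).re : ℂ)))) := by
    rw [secondDiff, e1, e2, heckeTerm_mul, heckeTerm_mul, neg_re, ofReal_neg]
    ring
  rw [e3, norm_mul, norm_heckeTerm hw]
  have e4 : ‖w‖ ^ (-3 - s.re) = ‖w‖ ^ (-1 - s.re) * (‖w‖ ^ 2)⁻¹ := by
    rw [← Real.rpow_natCast, ← Real.rpow_neg hwp.le, ← Real.rpow_add hwp]
    congr 1
    push_cast
    ring
  have e5 : ‖z‖ ^ 2 = ‖e‖ ^ 2 * (‖w‖ ^ 2)⁻¹ := by rw [hz, norm_div, div_pow, div_eq_mul_inv]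
  calc _ ≤ ‖w‖ ^ (-1 - s.re) * (K * ‖z‖ ^ 2 + K * ‖z‖ ^ 2) := by
        gcongr
        exact norm_add_le_of_le h1 h2
    _ = _ := by rw [e4, e5]; ring

/-! ### Lattice points and convergence. -/

/-- The point `c τ + d` of the lattice `ℤ τ + ℤ`. -/
def latticePoint (τ : ℍ) (v : ℤ × ℤ) : ℂ := v.1 * (τ : ℂ) + v.2

lemma latticePoint_add (τ : ℍ) (v w : ℤ × ℤ) :
    latticePoint τ (v + w) = latticePoint τ v + latticePoint τ w := by
  simp only [latticePoint, Prod.fst_add, Prod.snd_add]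
  push_cast
  ring

lemma latticePoint_neg (τ : ℍ) (v : ℤ × ℤ) : latticePoint τ (-v) = -latticePoint τ v := by
  simp only [latticePoint, Prod.fst_neg, Prod.snd_neg]
  push_cast
  ring

lemma latticePoint_sub (τ : ℍ) (v w : ℤ × ℤ) :
    latticePoint τ (v - w) = latticePoint τ v - latticePoint τ w := by
  rw [sub_eq_add_neg, latticePoint_add, latticePoint_neg, sub_eq_add_neg]

lemma norm_vec_eq (v : ℤ × ℤ) : ‖![v.1, v.2]‖ = ‖v‖ := by
  rw [EisensteinSeries.norm_eq_max_natAbs, Prod.norm_def, Int.norm_eq_abs, Int.norm_eq_abs]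
  simp [Nat.cast_natAbs]

lemma r_mul_norm_le_norm_latticePoint (τ : ℍ) (v : ℤ × ℤ) :
    EisensteinSeries.r τ * ‖v‖ ≤ ‖latticePoint τ v‖ := by
  rcases eq_or_ne v 0 with rfl | hv
  · simp
  · rw [← norm_vec_eq]
    refine EisensteinSeries.r_mul_max_le τ (x := ![v.1, v.2]) fun h ↦ hv ?_
    ext
    · simpa using congrFun h 0
    · simpa using congrFun h 1

lemma latticePoint_ne_zero (τ : ℍ) {v : ℤ × ℤ} (hv : v ≠ 0) : latticePoint τ v ≠ 0 := by
  rw [← norm_pos_iff]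
  exact (mul_pos (EisensteinSeries.r_pos τ) (norm_pos_iff.mpr hv)).trans_le
    (r_mul_norm_le_norm_latticePoint τ v)

lemma latticePoint_injective (τ : ℍ) : Function.Injective (latticePoint τ) := by
  intro v w h
  by_contra hne
  exact latticePoint_ne_zero τ (sub_ne_zero.mpr hne) (by rw [latticePoint_sub, h, sub_self])

lemma summable_norm_latticePoint_rpow (τ : ℍ) {k : ℝ} (hk : 2 < k) :
    Summable fun v : ℤ × ℤ ↦ ‖latticePoint τ v‖ ^ (-k) := by
  have h : Summable fun v : ℤ × ℤ ↦ ‖v‖ ^ (-k) := by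
    have := EisensteinSeries.summable_one_div_norm_rpow hk
    rw [← (finTwoArrowEquiv ℤ).symm.summable_iff] at this
    exact this.congr fun v ↦ by rw [← norm_vec_eq]; rfl
  refine (h.mul_left (EisensteinSeries.r τ ^ (-k))).of_nonneg_of_le (fun v ↦ by positivity)
    fun v ↦ ?_
  rcases eq_or_ne v 0 with rfl | hv
  · simp [latticePoint, Real.zero_rpow (show -k ≠ 0 by linarith)]
  · rw [← Real.mul_rpow (EisensteinSeries.r_pos τ).le (norm_nonneg _)]
    exact Real.rpow_le_rpow_of_nonpos
      (mul_pos (EisensteinSeries.r_pos τ) (norm_pos_iff.mpr hv))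
      (r_mul_norm_le_norm_latticePoint τ v) (by linarith)

lemma eventually_le_norm_latticePoint (τ : ℍ) (B : ℝ) :
    ∀ᶠ v in cofinite, B ≤ ‖latticePoint τ v‖ := by
  have h : Tendsto (fun v : ℤ × ℤ ↦ EisensteinSeries.r τ * ‖v‖) cofinite atTop := by
    refine Tendsto.const_mul_atTop (EisensteinSeries.r_pos τ) ?_
    rw [← cocompact_eq_cofinite]
    exact tendsto_norm_cocompact_atTop
  filter_upwards [h.eventually_ge_atTop B] with v hv
  exact hv.trans (r_mul_norm_le_norm_latticePoint τ v)

lemma summable_mul_heckeTerm (τ : ℍ) {χ : ℤ × ℤ → ℂ} (hχ : ∀ v, ‖χ v‖ ≤ 1) {s : ℂ}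
    (hs : 1 < s.re) : Summable fun v ↦ χ v * heckeTerm (latticePoint τ v) s := by
  refine (summable_norm_latticePoint_rpow τ (k := 1 + s.re) (by linarith)).of_norm_bounded
    fun v ↦ ?_
  rw [norm_mul]
  refine (mul_le_of_le_one_left (norm_nonneg _) (hχ v)).trans ?_
  rcases eq_or_ne (latticePoint τ v) 0 with h | h
  · simp only [h, heckeTerm_zero_left, norm_zero]
    positivity
  · rw [norm_heckeTerm h, neg_add']

/-! ### Series of second differences and summation by parts. -/

/-- A locally eventually dominated series of holomorphic functions has a holomorphic sum. -/
lemma differentiableOn_tsum_of_eventually_le {ι : Type*} {U : Set ℂ}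
    {F : ι → ℂ → ℂ} (hF : ∀ i, Differentiable ℂ (F i))
    (h : ∀ s₀ ∈ U, ∃ ε > 0, ∃ u : ι → ℝ, Summable u ∧
      ∀ᶠ i in cofinite, ∀ s ∈ Metric.ball s₀ ε, ‖F i s‖ ≤ u i) :
    DifferentiableOn ℂ (fun s ↦ ∑' i, F i s) U ∧ ∀ s ∈ U, Summable fun i ↦ F i s := by
  classical
  refine ⟨fun s₀ hs₀ ↦ ?_, fun s hs ↦ ?_⟩
  · obtain ⟨ε, hε, u, hu, hb⟩ := h s₀ hs₀
    have hM (i : ι) : ∃ M, ∀ s ∈ Metric.closedBall s₀ ε, ‖F i s‖ ≤ M :=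
      (isCompact_closedBall s₀ ε).exists_bound_of_continuousOn (hF i).continuous.continuousOn
    choose M hM using hM
    -- The finitely many terms violating the bound are majorized by their maximum on a compact ball.
    let u' : ι → ℝ := fun i ↦ if ∀ s ∈ Metric.ball s₀ ε, ‖F i s‖ ≤ u i then u i else M i
    have hu' : Summable u' := by
      refine (summable_congr_cofinite ?_).mpr hu
      filter_upwards [hb] with i hi
      exact if_pos hi
    have hd := differentiableOn_tsum_of_summable_norm (F := F) (U := Metric.ball s₀ ε) hu'
      (fun i ↦ (hF i).differentiableOn) Metric.isOpen_ball fun i s hs ↦ by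
        by_cases hi : ∀ s ∈ Metric.ball s₀ ε, ‖F i s‖ ≤ u i
        · simpa only [u', if_pos hi] using hi s hs
        · simpa only [u', if_neg hi] using hM i s (Metric.ball_subset_closedBall hs)
    exact (hd.differentiableAt (Metric.ball_mem_nhds s₀ hε)).differentiableWithinAt
  · obtain ⟨ε, hε, u, hu, hb⟩ := h s hs
    refine hu.of_norm_bounded_eventually ?_
    filter_upwards [hb] with i hi
    exact hi s (Metric.mem_ball_self hε)

lemma isOpen_re_gt (σ : ℝ) : IsOpen {s : ℂ | σ < s.re} := isOpen_lt continuous_const continuous_re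

/-- The gain of two powers makes the exponent 3 + Re s exceed 2, the summability threshold of a
rank-two lattice. -/
theorem tsum_mul_secondDiff (τ : ℍ) {χ : ℤ × ℤ → ℂ} (hχ : ∀ v, ‖χ v‖ ≤ 1) (e : ℂ) :
    DifferentiableOn ℂ (fun s ↦ ∑' v, χ v * secondDiff (latticePoint τ v) e s)
      {s : ℂ | -1 < s.re} ∧
    ∀ s ∈ {s : ℂ | -1 < s.re}, Summable fun v ↦ χ v * secondDiff (latticePoint τ v) e s := by
  refine differentiableOn_tsum_of_eventually_le
    (fun v ↦ (differentiable_secondDiff _ _).const_mul _) fun s₀ hs₀ ↦ ?_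
  obtain ⟨ε, hε, hε'⟩ : ∃ ε > 0, -1 < s₀.re - ε :=
    ⟨(1 + s₀.re) / 2, by have : -1 < s₀.re := hs₀; linarith,
      by have : -1 < s₀.re := hs₀; linarith⟩
  obtain ⟨C, hC⟩ := exists_norm_secondDiff_le e (‖s₀‖ + ε)
  refine ⟨ε, hε, fun v ↦ |C| * ‖latticePoint τ v‖ ^ (-(3 + (s₀.re - ε))),
    (summable_norm_latticePoint_rpow τ (by linarith)).mul_left _, ?_⟩
  -- The bound 1 makes powers monotone in the exponent; 2‖e‖ is the range of the Taylor estimate.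
  filter_upwards [eventually_le_norm_latticePoint τ (max 1 (2 * ‖e‖))] with v hv s hs
  have h1 : 1 ≤ ‖latticePoint τ v‖ := (le_max_left _ _).trans hv
  have hs' : ‖s - s₀‖ < ε := by simpa [dist_eq_norm] using hs
  have hsn : ‖s‖ ≤ ‖s₀‖ + ε := by
    have := norm_add_le (s - s₀) s₀
    simp only [sub_add_cancel] at this
    linarith
  have hre : s₀.re - ε ≤ s.re := by
    have := (abs_le.mp (abs_re_le_norm (s - s₀))).1
    rw [sub_re] at this
    linarith
  rw [norm_mul]
  calc ‖χ v‖ * ‖secondDiff (latticePoint τ v) e s‖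
      ≤ ‖secondDiff (latticePoint τ v) e s‖ := mul_le_of_le_one_left (norm_nonneg _) (hχ v)
    _ ≤ C * ‖latticePoint τ v‖ ^ (-3 - s.re) :=
      hC _ _ (norm_pos_iff.mp (by linarith)) ((le_max_right _ _).trans hv) hsn
    _ ≤ |C| * ‖latticePoint τ v‖ ^ (-(3 + (s₀.re - ε))) := by
      refine mul_le_mul (le_abs_self C) (Real.rpow_le_rpow_of_exponent_le h1 ?_) (by positivity)
        (abs_nonneg C)
      linarith

lemma hasSum_mul_heckeTerm_add (τ : ℍ) {χ : ℤ × ℤ → ℂ} (hχ : ∀ v, ‖χ v‖ ≤ 1)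
    (e : ℤ × ℤ) {s : ℂ} (hs : 1 < s.re) :
    HasSum (fun v ↦ χ v * heckeTerm (latticePoint τ (v + e)) s)
      (∑' v, χ (v - e) * heckeTerm (latticePoint τ v) s) := by
  have h := (summable_mul_heckeTerm τ (χ := fun v ↦ χ (v - e)) (fun v ↦ hχ _) hs).hasSum
  rw [← (Equiv.addRight e).hasSum_iff] at h
  simpa [Function.comp_def] using h

/-- Summation by parts: second differences may be moved to the coefficients. -/
lemma tsum_mul_secondDiff_eq (τ : ℍ) {χ : ℤ × ℤ → ℂ} (hχ : ∀ v, ‖χ v‖ ≤ 1)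
    (e : ℤ × ℤ) {s : ℂ} (hs : 1 < s.re) :
    ∑' v, χ v * secondDiff (latticePoint τ v) (latticePoint τ e) s =
      ∑' v, χ (v - e) * heckeTerm (latticePoint τ v) s +
      ∑' v, χ (v + e) * heckeTerm (latticePoint τ v) s -
      2 * ∑' v, χ v * heckeTerm (latticePoint τ v) s := by
  have h1 := hasSum_mul_heckeTerm_add τ hχ e hs
  have h2 := hasSum_mul_heckeTerm_add τ hχ (-e) hs
  have h3 := (summable_mul_heckeTerm τ hχ hs).hasSum.mul_left 2
  simp only [sub_neg_eq_add] at h2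
  rw [← ((h1.add h2).sub h3).tsum_eq]
  refine tsum_congr fun v ↦ ?_
  rw [secondDiff, latticePoint_add, latticePoint_add, latticePoint_neg, ← sub_eq_add_neg]
  ring

/-! ### Continuation of the sums over residue classes. -/

/-- Reduction of a pair of integers modulo `N`. -/
def residue (N : ℕ) : ℤ × ℤ →+ ZMod N × ZMod N :=
  (Int.castAddHom (ZMod N)).prodMap (Int.castAddHom (ZMod N))

lemma residue_apply (N : ℕ) (v : ℤ × ℤ) : residue N v = ((v.1 : ZMod N), (v.2 : ZMod N)) := rfl

/-- The indicator function of a residue class modulo `N`. -/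
def classIndicator (N : ℕ) (u : ZMod N × ZMod N) (v : ℤ × ℤ) : ℂ := if residue N v = u then 1 else 0

lemma norm_classIndicator_le (N : ℕ) (u : ZMod N × ZMod N) (v : ℤ × ℤ) :
    ‖classIndicator N u v‖ ≤ 1 := by
  rw [classIndicator]
  split_ifs <;> simp

/-- The part of Hecke's series belonging to a residue class modulo `N`. -/
def classSum (N : ℕ) (τ : ℍ) (u : ZMod N × ZMod N) (s : ℂ) : ℂ :=
  ∑' v, classIndicator N u v * heckeTerm (latticePoint τ v) s

lemma classIndicator_sub (N : ℕ) (u : ZMod N × ZMod N) (v e : ℤ × ℤ) :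
    classIndicator N u (v - e) = classIndicator N (u + residue N e) v := by
  simp only [classIndicator, map_sub, sub_eq_iff_eq_add]

lemma classIndicator_add (N : ℕ) (u : ZMod N × ZMod N) (v e : ℤ × ℤ) :
    classIndicator N u (v + e) = classIndicator N (u - residue N e) v := by
  simp only [classIndicator, map_add, eq_sub_iff_add_eq]

/-- The zero class is stable under v ↦ -v, and the summand is odd. -/
lemma classSum_zero (N : ℕ) (τ : ℍ) (s : ℂ) : classSum N τ 0 s = 0 := by
  have h : classSum N τ 0 s = -classSum N τ 0 s := by
    conv_lhs => rw [classSum, ← (Equiv.neg (ℤ × ℤ)).tsum_eq]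
    rw [classSum, ← tsum_neg]
    refine tsum_congr fun v ↦ ?_
    simp [classIndicator, latticePoint_neg, heckeTerm_neg]
  exact self_eq_neg.mp h

/-- `H` continues holomorphically from `Re s > 1` to `Re s > -1`. -/
def Continues (H : ℂ → ℂ) : Prop :=
  ∃ F : ℂ → ℂ, DifferentiableOn ℂ F {s : ℂ | -1 < s.re} ∧ ∀ s : ℂ, 1 < s.re → F s = H s

lemma Continues.add {H K : ℂ → ℂ} (hH : Continues H) (hK : Continues K) :
    Continues fun s ↦ H s + K s := by
  obtain ⟨F, hF, hF'⟩ := hH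
  obtain ⟨E, hE, hE'⟩ := hK
  exact ⟨fun s ↦ F s + E s, hF.add hE, fun s hs ↦ by simp only [hF' s hs, hE' s hs]⟩

lemma Continues.const_mul {H : ℂ → ℂ} (hH : Continues H) (c : ℂ) : Continues fun s ↦ c * H s := by
  obtain ⟨F, hF, hF'⟩ := hH
  exact ⟨fun s ↦ c * F s, hF.const_mul c, fun s hs ↦ by simp only [hF' s hs]⟩

lemma continues_classSum_secondDiff (N : ℕ) (τ : ℍ) (u : ZMod N × ZMod N) (e : ℤ × ℤ) :
    Continues fun s ↦ classSum N τ (u + residue N e) s + classSum N τ (u - residue N e) s -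
      2 * classSum N τ u s := by
  refine ⟨_, (tsum_mul_secondDiff τ (norm_classIndicator_le N u) (latticePoint τ e)).1,
    fun s hs ↦ ?_⟩
  rw [tsum_mul_secondDiff_eq τ (norm_classIndicator_le N u) e hs]
  simp only [classIndicator_sub, classIndicator_add, classSum]

/-- A sequence with zero second differences and initial value 0 is linear; here this holds modulo
functions that continue. -/
lemma continues_classSum_nsmul (N : ℕ) (τ : ℍ) (e : ℤ × ℤ) (n : ℕ) :
    Continues fun s ↦ classSum N τ (n • residue N e) s - n * classSum N τ (residue N e) s := by
  induction n using Nat.twoStepInduction with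
  | zero => exact ⟨0, differentiableOn_const 0, fun s _ ↦ by simp [classSum_zero]⟩
  | one => exact ⟨0, differentiableOn_const 0, fun s _ ↦ by simp⟩
  | more n h0 h1 =>
    have h := ((continues_classSum_secondDiff N τ ((n + 1) • residue N e) e).add
      (h1.const_mul 2)).add (h0.const_mul (-1))
    convert h using 1
    ext s
    rw [← succ_nsmul, show (n + 1) • residue N e - residue N e = n • residue N e by
      rw [succ_nsmul, add_sub_cancel_right]]
    push_cast
    ring

/-- The classes modulo `N` are `N`-torsion, so each class sum is a combination of sums of second
differences. -/
lemma continues_classSum {N : ℕ} (hN : 0 < N) (τ : ℍ) (e : ℤ × ℤ) :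
    Continues (classSum N τ (residue N e)) := by
  have hN' : (N : ℂ) ≠ 0 := by exact_mod_cast hN.ne'
  have h := (continues_classSum_nsmul N τ e N).const_mul (-(N : ℂ)⁻¹)
  convert h using 1
  ext s
  have h0 : N • residue N e = 0 := by
    ext <;> simp
  rw [h0, classSum_zero]
  field_simp
  ring

/-! ### Identification of the class sums with Φ. -/

lemma latticePoint_mem_summationSet {N : ℕ} (hN : 0 < N) (τ : ℍ) (a b : ℤ) (v : ℤ × ℤ) :
    latticePoint τ v ∈ summationSet N (lattice τ) (torsionPoint N a b τ) ↔
      latticePoint τ v ≠ 0 ∧ residue N v = residue N (a, b) := by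
  have hN' : (N : ℂ) ≠ 0 := by exact_mod_cast hN.ne'
  refine and_congr_right fun _ ↦ ?_
  rw [lattice, Submodule.mem_span_pair, residue_apply, residue_apply, Prod.mk.injEq,
    eq_comm, ZMod.intCast_eq_intCast_iff_dvd_sub, @eq_comm _ (v.2 : ZMod N),
    ZMod.intCast_eq_intCast_iff_dvd_sub]
  have key (m n : ℤ) : m • (τ : ℂ) + n • (1 : ℂ) =
      latticePoint τ v / N - torsionPoint N a b τ ↔ v.1 - a = N * m ∧ v.2 - b = N * n := by
    have e : m • (τ : ℂ) + n • (1 : ℂ) = latticePoint τ v / N - torsionPoint N a b τ ↔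
        latticePoint τ (N * m, N * n) = latticePoint τ (v.1 - a, v.2 - b) := by
      simp only [latticePoint, torsionPoint, zsmul_eq_mul]
      push_cast
      rw [← sub_div, eq_div_iff hN']
      constructor <;> intro h <;> linear_combination h
    rw [e, (latticePoint_injective τ).eq_iff, Prod.mk.injEq, eq_comm, @eq_comm _ (_ * n)]
  simp only [key]
  constructor
  · rintro ⟨m, n, h1, h2⟩
    exact ⟨⟨m, h1⟩, ⟨n, h2⟩⟩
  · rintro ⟨⟨m, h1⟩, ⟨n, h2⟩⟩
    exact ⟨m, n, h1, h2⟩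

lemma mem_range_latticePoint_of_mem_summationSet {N : ℕ} (hN : 0 < N) (τ : ℍ) {a b : ℤ} {ω : ℂ}
    (h : ω ∈ summationSet N (lattice τ) (torsionPoint N a b τ)) :
    ω ∈ Set.range (latticePoint τ) := by
  have hN' : (N : ℂ) ≠ 0 := by exact_mod_cast hN.ne'
  obtain ⟨m, n, hmn⟩ := Submodule.mem_span_pair.mp h.2
  refine ⟨(N * m + a, N * n + b), ?_⟩
  simp only [latticePoint, torsionPoint, zsmul_eq_mul] at hmn ⊢
  rw [← sub_div, eq_div_iff hN'] at hmn
  push_cast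
  linear_combination hmn

lemma hasSum_summationSet {N : ℕ} (hN : 0 < N) (τ : ℍ) (a b : ℤ) {s : ℂ} (hs : 1 < s.re) :
    HasSum (fun ω : summationSet N (lattice τ) (torsionPoint N a b τ) ↦
      (ω : ℂ)⁻¹ * ((‖(ω : ℂ)‖ : ℝ) : ℂ) ^ (-s)) (classSum N τ (residue N (a, b)) s) := by
  classical
  have h := (summable_mul_heckeTerm τ (norm_classIndicator_le N (residue N (a, b))) hs).hasSum
  rw [classSum]
  change HasSum ((fun ω : ℂ ↦ heckeTerm ω s) ∘
    ((↑) : summationSet N (lattice τ) (torsionPoint N a b τ) → ℂ)) _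
  rw [hasSum_subtype_iff_indicator, ← (latticePoint_injective τ).hasSum_iff]
  · convert h using 1
    ext v
    rw [Function.comp_apply, Set.indicator_apply, latticePoint_mem_summationSet hN, classIndicator]
    -- The origin is excluded from the summation set, but its term is 0 anyway.
    by_cases h0 : latticePoint τ v = 0
    · simp [h0]
    · by_cases h1 : residue N v = residue N (a, b) <;> simp [h0, h1]
  · intro ω hω
    exact Set.indicator_of_notMem
      (fun h ↦ hω (mem_range_latticePoint_of_mem_summationSet hN τ h)) _

lemma exists_isContinuation {N : ℕ} (hN : 0 < N) (τ : ℍ) (a b : ℤ) :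
    ∃ F, IsContinuation N (lattice τ) (torsionPoint N a b τ) (-1) F ∧
      ∀ s : ℂ, 1 < s.re → F s = classSum N τ (residue N (a, b)) s := by
  obtain ⟨F, hF, hF'⟩ := continues_classSum hN τ (a, b)
  exact ⟨F, ⟨hF, fun s hs ↦ hF' s hs ▸ hasSum_summationSet hN τ a b hs⟩, hF'⟩

/-! ### The twisted sum at s = 0. -/

/-- The character `(c, d) ↦ ζ_N^{kc} (-1)^d`. -/
def twist (N : ℕ) (k : ℤ) (v : ℤ × ℤ) : ℂ := zetaN N ^ (k * v.1) * (-1) ^ v.2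

lemma zetaN_ne_zero (N : ℕ) : zetaN N ≠ 0 := exp_ne_zero _

lemma norm_zetaN (N : ℕ) : ‖zetaN N‖ = 1 := by
  rw [zetaN, show (2 * Real.pi * I / N : ℂ) = ((2 * Real.pi / N : ℝ) : ℂ) * I by push_cast; ring,
    norm_exp_ofReal_mul_I]

lemma norm_twist (N : ℕ) (k : ℤ) (v : ℤ × ℤ) : ‖twist N k v‖ = 1 := by
  simp [twist, norm_zetaN]

lemma zetaN_pow (N : ℕ) : zetaN N ^ N = 1 := by
  rcases Nat.eq_zero_or_pos N with rfl | hN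
  · simp
  · have hN' : (N : ℂ) ≠ 0 := by exact_mod_cast hN.ne'
    rw [zetaN, ← exp_nat_mul, mul_div_cancel₀ _ hN', exp_two_pi_mul_I]

/-- Evenness of N makes (-1)^d well defined modulo N. -/
lemma twist_eq_of_residue {N : ℕ} (hN2 : 2 ∣ N) (k : ℤ) {v w : ℤ × ℤ}
    (h : residue N v = residue N w) : twist N k v = twist N k w := by
  rw [residue_apply, residue_apply, Prod.mk.injEq, ZMod.intCast_eq_intCast_iff_dvd_sub,
    ZMod.intCast_eq_intCast_iff_dvd_sub] at h
  obtain ⟨⟨c, hc⟩, ⟨d, hd⟩⟩ := h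
  obtain ⟨M, hM⟩ := hN2
  have h1 : w.1 = v.1 + N * c := by linarith
  have h2 : w.2 = v.2 + 2 * (M * d) := by
    rw [hM] at hd
    push_cast at hd
    linarith
  rw [twist, twist, h1, h2, zpow_add₀ (by norm_num), zpow_mul (-1 : ℂ) 2,
    show k * (v.1 + N * c) = k * v.1 + N * (k * c) by ring, zpow_add₀ (zetaN_ne_zero N),
    zpow_mul _ (N : ℤ), zpow_natCast, zetaN_pow]
  simp

lemma twist_eq_sum_classIndicator {N : ℕ} (hN : 0 < N) (hN2 : 2 ∣ N) (k : ℤ) (v : ℤ × ℤ) :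
    twist N k v = ∑ a ∈ Finset.range N, ∑ b ∈ Finset.range N,
      twist N k (a, b) * classIndicator N (residue N (a, b)) v := by
  have : NeZero N := ⟨hN.ne'⟩
  have e (x : ℤ) (a : ℕ) (ha : a ∈ Finset.range N) :
      (x : ZMod N) = ((a : ℤ) : ZMod N) ↔ a = (x : ZMod N).val := by
    constructor
    · intro h
      rw [h, Int.cast_natCast, ZMod.val_cast_of_lt (Finset.mem_range.mp ha)]
    · rintro rfl
      simp
  rw [Finset.sum_eq_single (v.1 : ZMod N).val, Finset.sum_eq_single (v.2 : ZMod N).val]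
  · have h : residue N v = residue N (((v.1 : ZMod N).val : ℤ), ((v.2 : ZMod N).val : ℤ)) := by
      simp [residue_apply]
    rw [classIndicator, if_pos h, mul_one, twist_eq_of_residue hN2 k h]
  · intro b hb hne
    rw [classIndicator, if_neg, mul_zero]
    rw [residue_apply, residue_apply, Prod.mk.injEq]
    exact fun h ↦ hne ((e _ _ hb).mp h.2)
  · intro h
    exact absurd (Finset.mem_range.mpr (ZMod.val_lt _)) h
  · intro a ha hne
    refine Finset.sum_eq_zero fun b _ ↦ ?_
    rw [classIndicator, if_neg, mul_zero]
    rw [residue_apply, residue_apply, Prod.mk.injEq]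
    exact fun h ↦ hne ((e _ _ ha).mp h.1)
  · intro h
    exact absurd (Finset.mem_range.mpr (ZMod.val_lt _)) h

lemma sum_twist_mul_classSum {N : ℕ} (hN : 0 < N) (hN2 : 2 ∣ N) (k : ℤ) (τ : ℍ) {s : ℂ}
    (hs : 1 < s.re) :
    ∑ a ∈ Finset.range N, ∑ b ∈ Finset.range N,
      twist N k (a, b) * classSum N τ (residue N (a, b)) s =
    ∑' v, twist N k v * heckeTerm (latticePoint τ v) s := by
  have h : HasSum (fun v ↦ ∑ a ∈ Finset.range N, ∑ b ∈ Finset.range N, twist N k (a, b) *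
      (classIndicator N (residue N (a, b)) v * heckeTerm (latticePoint τ v) s))
      (∑ a ∈ Finset.range N, ∑ b ∈ Finset.range N,
        twist N k (a, b) * classSum N τ (residue N (a, b)) s) :=
    hasSum_sum fun a _ ↦ hasSum_sum fun b _ ↦
      (summable_mul_heckeTerm τ (norm_classIndicator_le N _) hs).hasSum.mul_left _
  rw [← h.tsum_eq]
  refine tsum_congr fun v ↦ ?_
  rw [twist_eq_sum_classIndicator hN hN2 k v]
  simp only [Finset.sum_mul, mul_assoc]

/-- The twisted sum of Hecke's Eisenstein series, as an absolutely convergent series. -/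
theorem sum_twist_mul_Gab {N : ℕ} (hN : 0 < N) (hN2 : 2 ∣ N) (k : ℤ) (τ : ℍ) :
    ∑ a ∈ Finset.range N, ∑ b ∈ Finset.range N, twist N k (a, b) * Gab N a b τ =
      -(1 / 4) * ∑' v, twist N k v * secondDiff (latticePoint τ v) 1 0 := by
  choose F hF hF' using exists_isContinuation hN τ
  have hG (a b : ℤ) : Gab N a b τ = F a b 0 := G_eq_of_isContinuation (by norm_num) (hF a b)
  simp only [hG]
  have hU := isOpen_re_gt (-1)
  have h1 : AnalyticOnNhd ℂ (fun s ↦ ∑ a ∈ Finset.range N, ∑ b ∈ Finset.range N,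
      twist N k (a, b) * F a b s) {s : ℂ | -1 < s.re} :=
    DifferentiableOn.analyticOnNhd (DifferentiableOn.fun_sum fun a _ ↦
      DifferentiableOn.fun_sum fun b _ ↦ (hF a b).1.const_mul _) hU
  have h2 : AnalyticOnNhd ℂ (fun s ↦ -(1 / 4) * ∑' v, twist N k v *
      secondDiff (latticePoint τ v) 1 s) {s : ℂ | -1 < s.re} :=
    ((tsum_mul_secondDiff τ (fun v ↦ (norm_twist N k v).le) 1).1.const_mul _).analyticOnNhd hU
  -- Both sides are analytic on Re s > -1, so it suffices to compare them near s = 2, where the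
  -- series converge absolutely.
  refine h1.eqOn_of_preconnected_of_eventuallyEq h2 (convex_halfSpace_re_gt _).isPreconnected
    (z₀ := 2) (by norm_num) ?_ (by simp)
  filter_upwards [(isOpen_re_gt 1).mem_nhds (show (2 : ℂ) ∈ {s : ℂ | 1 < s.re} by simp)] with s hs
  simp only [hF' _ _ s hs]
  rw [sum_twist_mul_classSum hN hN2 k τ hs]
  have h3 := tsum_mul_secondDiff_eq τ (fun v ↦ (norm_twist N k v).le) (0, 1) hs
  have e1 : latticePoint τ (0, 1) = 1 := by simp [latticePoint]
  -- Both shifts flip the sign, so the second difference of the character is -4 times it.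
  have e2 (v : ℤ × ℤ) : twist N k (v - (0, 1)) = -twist N k v := by
    simp [twist, zpow_sub₀, div_neg]
  have e3 (v : ℤ × ℤ) : twist N k (v + (0, 1)) = -twist N k v := by
    simp [twist, zpow_add₀]
  simp only [e1, e2, e3, neg_mul, tsum_neg] at h3
  rw [h3]
  ring

lemma summable_twist_mul_secondDiff (N : ℕ) (k : ℤ) (τ : ℍ) :
    Summable fun v ↦ twist N k v * secondDiff (latticePoint τ v) 1 0 :=
  (tsum_mul_secondDiff τ (fun v ↦ (norm_twist N k v).le) 1).2 0 (by simp)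

/-! ### Evaluation of a row by the cotangent expansion. -/

lemma hasSum_of_eq {ι : Type*} {f g : ι → ℂ} {a b : ℂ} (h : HasSum f a) (hfg : ∀ i, f i = g i)
    (hab : a = b) : HasSum g b := by
  rwa [← funext hfg, ← hab]

lemma hasSum_int_of_even_odd {f : ℤ → ℂ} {a b : ℂ} (ha : HasSum (fun j ↦ f (2 * j)) a)
    (hb : HasSum (fun j ↦ f (2 * j + 1)) b) : HasSum f (a + b) := by
  have h1 : Function.Injective fun j : ℤ ↦ 2 * j := fun i j h ↦ by simpa using h
  have h2 : Function.Injective fun j : ℤ ↦ 2 * j + 1 := fun i j h ↦ by simpa using h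
  have hc : IsCompl (Set.range fun j : ℤ ↦ 2 * j) (Set.range fun j : ℤ ↦ 2 * j + 1) := by
    have e0 : (Set.range fun j : ℤ ↦ 2 * j) = {n | Even n} := by
      ext n
      simp [even_iff_exists_two_mul, eq_comm (a := n)]
    have e1 : (Set.range fun j : ℤ ↦ 2 * j + 1) = {n | Odd n} := by
      ext n
      simp [odd_iff_exists_bit1, eq_comm (a := n)]
    rw [e0, e1]
    exact Int.isCompl_even_odd
  exact HasSum.add_isCompl hc (h1.hasSum_range_iff.mpr ha) (h2.hasSum_range_iff.mpr hb)

lemma hasSum_symmetric_pairs {x : ℂ} (hx : x ∈ integerComplement) :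
    HasSum (fun n : ℕ ↦ (x + ((n + 1 : ℕ) : ℤ))⁻¹ + (x + (-((n + 1 : ℕ) : ℤ) : ℤ))⁻¹)
      (Real.pi * cot (Real.pi * x) - x⁻¹) := by
  have h := (summable_cotTerm hx).hasSum
  rw [← cot_series_rep' hx, one_div] at h
  convert h using 1
  ext n
  rw [cotTerm, one_div, one_div, add_comm]
  push_cast
  rw [← sub_eq_add_neg]

/-- The three series are not absolutely convergent separately. The combined one is, so it may be
summed over pairs j, -j, where each part is a cotangent series. -/
lemma tsum_secondDiff_inv {x y w : ℂ} (hx : x ∈ integerComplement) (hy : y ∈ integerComplement)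
    (hw : w ∈ integerComplement)
    (h : Summable fun j : ℤ ↦ (x + j)⁻¹ + (y + j)⁻¹ - 2 * (w + j)⁻¹) :
    ∑' j : ℤ, ((x + j)⁻¹ + (y + j)⁻¹ - 2 * (w + j)⁻¹) =
      Real.pi * cot (Real.pi * x) + Real.pi * cot (Real.pi * y) -
        2 * (Real.pi * cot (Real.pi * w)) := by
  have h1 := (hasSum_nat_add_iff' 1).mpr h.hasSum.nat_add_neg
  have h2 := ((hasSum_symmetric_pairs hx).add (hasSum_symmetric_pairs hy)).sub
    ((hasSum_symmetric_pairs hw).mul_left 2)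
  have h3 := h1.unique (hasSum_of_eq h2 (fun n ↦ by ring) rfl)
  simp only [Finset.range_one, Finset.sum_singleton, Nat.cast_zero, neg_zero, Int.cast_zero,
    add_zero] at h3
  linear_combination h3

lemma mem_integerComplement_of_im_pos {x : ℂ} (hx : 0 < x.im) : x ∈ integerComplement :=
  UpperHalfPlane.coe_mem_integerComplement ⟨x, hx⟩

lemma pi_mul_cot_eq {x : ℂ} (hx : 0 < x.im) :
    Real.pi * cot (Real.pi * x) =
      Real.pi * I - 2 * Real.pi * I * (1 - exp (2 * Real.pi * I * x))⁻¹ := by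
  have h := pi_mul_cot_pi_q_exp ⟨x, hx⟩
  rwa [tsum_geometric_of_norm_lt_one (UpperHalfPlane.norm_exp_two_pi_I_lt_one ⟨x, hx⟩)] at h

/-- After halving, the steps ±1 become shifts of x by ±1/2, which negate exp (2πix). -/
lemma hasSum_secondDiff_half {x : ℂ} (hx : 0 < x.im)
    (h : Summable fun j : ℤ ↦ secondDiff (2 * x + 2 * j) 1 0) :
    HasSum (fun j : ℤ ↦ secondDiff (2 * x + 2 * j) 1 0)
      (2 * Real.pi * I * ((1 - exp (2 * Real.pi * I * x))⁻¹ -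
        (1 + exp (2 * Real.pi * I * x))⁻¹)) := by
  have e (j : ℤ) : secondDiff (2 * x + 2 * j) 1 0 =
      2⁻¹ * ((x + 1 / 2 + j)⁻¹ + (x - 1 / 2 + j)⁻¹ - 2 * (x + j)⁻¹) := by
    simp only [secondDiff, heckeTerm_zero_right]
    rw [show 2 * x + 2 * j + 1 = 2 * (x + 1 / 2 + j) by ring,
      show 2 * x + 2 * j - 1 = 2 * (x - 1 / 2 + j) by ring,
      show 2 * x + 2 * (j : ℂ) = 2 * (x + j) by ring]
    simp only [mul_inv]
    ring
  have h' : Summable fun j : ℤ ↦ (x + 1 / 2 + j)⁻¹ + (x - 1 / 2 + j)⁻¹ - 2 * (x + j)⁻¹ := by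
    simp only [e] at h
    exact (summable_mul_left_iff (by norm_num)).mp h
  have i1 : 0 < (x + 1 / 2).im := by simpa using hx
  have i2 : 0 < (x - 1 / 2).im := by simpa using hx
  have e1 : exp (2 * Real.pi * I * (x + 1 / 2)) = -exp (2 * Real.pi * I * x) := by
    rw [show 2 * Real.pi * I * (x + 1 / 2) = 2 * Real.pi * I * x + Real.pi * I by ring, exp_add,
      exp_pi_mul_I]
    ring
  have e2 : exp (2 * Real.pi * I * (x - 1 / 2)) = -exp (2 * Real.pi * I * x) := by
    rw [show 2 * Real.pi * I * (x - 1 / 2) = 2 * Real.pi * I * x - Real.pi * I by ring, exp_sub,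
      exp_pi_mul_I]
    ring
  have h2 := tsum_secondDiff_inv (mem_integerComplement_of_im_pos i1)
    (mem_integerComplement_of_im_pos i2) (mem_integerComplement_of_im_pos hx) h'
  rw [pi_mul_cot_eq i1, pi_mul_cot_eq i2, pi_mul_cot_eq hx, e1, e2, sub_neg_eq_add] at h2
  have h3 := h'.hasSum.mul_left 2⁻¹
  rw [h2] at h3
  simp only [e]
  refine hasSum_of_eq h3 (fun _ ↦ rfl) ?_
  ring

lemma norm_exp_pi_I_lt_one {z : ℂ} (hz : 0 < z.im) : ‖exp (Real.pi * I * z)‖ < 1 := by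
  rw [norm_exp, Real.exp_lt_one_iff]
  simp [Real.pi_pos, hz]

/-- The partial fraction expansion of `1 / sin`, summed by parts. -/
lemma tsum_alternating_secondDiff {z : ℂ} (hz : 0 < z.im)
    (h : Summable fun d : ℤ ↦ (-1 : ℂ) ^ d * secondDiff (z + d) 1 0) :
    ∑' d : ℤ, (-1 : ℂ) ^ d * secondDiff (z + d) 1 0 =
      8 * Real.pi * I * (exp (Real.pi * I * z) / (1 - exp (Real.pi * I * z) ^ 2)) := by
  have e0 (j : ℤ) : (-1 : ℂ) ^ (2 * j) * secondDiff (z + (2 * j : ℤ)) 1 0 =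
      secondDiff (2 * (z / 2) + 2 * j) 1 0 := by
    rw [zpow_mul]
    norm_num
    rw [mul_div_cancel₀ _ two_ne_zero]
  have e1 (j : ℤ) : (-1 : ℂ) ^ (2 * j + 1) * secondDiff (z + (2 * j + 1 : ℤ)) 1 0 =
      -secondDiff (2 * ((z + 1) / 2) + 2 * j) 1 0 := by
    rw [zpow_add₀ (by norm_num), zpow_mul]
    norm_num
    congr 1
    ring
  have i0 : 0 < (z / 2).im := by simpa using hz
  have i1 : 0 < ((z + 1) / 2).im := by simpa using hz
  have s0 := h.comp_injective (i := fun j : ℤ ↦ 2 * j) fun i j h ↦ by simpa using h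
  have s1 := h.comp_injective (i := fun j : ℤ ↦ 2 * j + 1) fun i j h ↦ by simpa using h
  simp only [Function.comp_def, e0, e1] at s0 s1
  have h0 := hasSum_secondDiff_half i0 s0
  have h1 := (hasSum_secondDiff_half i1 (by simpa using s1.neg)).neg
  simp only [← e0] at h0
  simp only [← e1] at h1
  rw [(hasSum_int_of_even_odd (f := fun d : ℤ ↦ (-1 : ℂ) ^ d * secondDiff (z + d) 1 0)
    h0 h1).tsum_eq]
  have y0 : exp (2 * Real.pi * I * (z / 2)) = exp (Real.pi * I * z) := by
    congr 1
    ring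
  have y1 : exp (2 * Real.pi * I * ((z + 1) / 2)) = -exp (Real.pi * I * z) := by
    rw [show 2 * Real.pi * I * ((z + 1) / 2) = Real.pi * I * z + Real.pi * I by ring, exp_add,
      exp_pi_mul_I]
    ring
  rw [y0, y1]
  set y := exp (Real.pi * I * z) with hy
  have hlt := norm_exp_pi_I_lt_one hz
  rw [← hy] at hlt
  have n0 : 1 - y ≠ 0 := fun h ↦ by
    rw [← sub_eq_zero.mp h] at hlt
    simp at hlt
  have n1 : 1 + y ≠ 0 := fun h ↦ by
    rw [show y = -1 by linear_combination h] at hlt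
    simp at hlt
  have n2 : 1 - y ^ 2 ≠ 0 := by
    rw [show 1 - y ^ 2 = (1 - y) * (1 + y) by ring]
    exact mul_ne_zero n0 n1
  rw [sub_neg_eq_add, ← sub_eq_add_neg 1 y]
  field_simp
  ring

/-! ### The double series of h_k. -/

lemma hasSum_odd_pow {y : ℂ} (hy : ‖y‖ < 1) :
    HasSum (fun m : ℕ+ ↦ if Odd (m : ℕ) then y ^ (m : ℕ) else 0) (y / (1 - y ^ 2)) := by
  have h2 : ‖y ^ 2‖ < 1 := by
    rw [norm_pow]
    exact pow_lt_one₀ (norm_nonneg _) hy two_ne_zero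
  have h := (hasSum_geometric_of_norm_lt_one h2).mul_left y
  rw [← div_eq_mul_inv] at h
  have hi : Function.Injective fun j : ℕ ↦ Nat.succPNat (2 * j) := fun i j hij ↦ by
    simpa using congrArg PNat.val hij
  rw [← hi.hasSum_iff]
  · refine hasSum_of_eq h (fun j ↦ ?_) rfl
    simp [pow_succ', pow_mul]
  · intro m hm
    refine if_neg fun ⟨j, hj⟩ ↦ hm ⟨j, PNat.eq hj.symm⟩

lemma norm_qHalf_lt_one (τ : ℍ) : ‖qHalf τ‖ < 1 := norm_exp_pi_I_lt_one τ.2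

/-- The terms of the double series of `h_k`, up to sign. -/
def doubleTerm (N : ℕ) (k : ℤ) (τ : ℍ) (p : ℕ+ × ℕ+) : ℂ :=
  (zetaN N ^ (k * (p.1 : ℕ)) - zetaN N ^ (-(k * (p.1 : ℕ)))) *
    if Odd (p.2 : ℕ) then qHalf τ ^ (p.1 * p.2 : ℕ) else 0

lemma summable_norm_doubleTerm (N : ℕ) (k : ℤ) (τ : ℍ) :
    Summable fun p ↦ ‖doubleTerm N k τ p‖ := by
  have h := (summable_prod_mul_pow 0 (r := ‖qHalf τ‖) (by simpa using norm_qHalf_lt_one τ)).mul_left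
    2
  refine h.of_nonneg_of_le (fun _ ↦ norm_nonneg _) fun p ↦ ?_
  rw [doubleTerm, norm_mul, pow_zero, one_mul]
  refine mul_le_mul ?_ ?_ (norm_nonneg _) (by norm_num)
  · refine (norm_sub_le _ _).trans ?_
    norm_num [norm_zpow, norm_zetaN]
  · split_ifs
    · rw [norm_pow]
    · simp

/-- The term of `h_k` of index `n` collects the terms of the double series with `c m = n`. -/
lemma sum_doubleTerm_divisorsAntidiagonal (N : ℕ) (k : ℤ) (τ : ℍ) (n : ℕ+) :
    ∑' x : Nat.divisorsAntidiagonal n, doubleTerm N k τ (sigmaAntidiagonalEquivProd ⟨n, x⟩) =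
      -hTerm N k τ n := by
  let f : ℕ → ℕ → ℂ := fun c m ↦ (zetaN N ^ (k * (c : ℤ)) - zetaN N ^ (-(k * (c : ℤ)))) *
    if Odd m then qHalf τ ^ (c * m) else 0
  have h (x : Nat.divisorsAntidiagonal n) :
      doubleTerm N k τ (sigmaAntidiagonalEquivProd ⟨n, x⟩) = f x.1.1 x.1.2 := rfl
  simp only [h, tsum_fintype, Finset.univ_eq_attach]
  rw [(n : ℕ).divisorsAntidiagonal.sum_attach (fun x ↦ f x.1 x.2),
    Nat.sum_divisorsAntidiagonal' (fun x y ↦ f x y), hTerm, hCoeff, neg_mul, neg_neg,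
    Finset.sum_mul, Finset.sum_filter]
  refine Finset.sum_congr rfl fun m hm ↦ ?_
  simp only [f, Nat.div_mul_cancel (Nat.dvd_of_mem_divisors hm)]
  split_ifs <;> simp

lemma summable_norm_hTerm (N : ℕ) (k : ℤ) (τ : ℍ) : Summable fun n ↦ ‖hTerm N k τ n‖ := by
  have h := sigmaAntidiagonalEquivProd.summable_iff.mpr (summable_norm_doubleTerm N k τ)
  refine h.sigma.of_nonneg_of_le (fun _ ↦ norm_nonneg _) fun n ↦ ?_
  rw [← norm_neg, ← sum_doubleTerm_divisorsAntidiagonal]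
  exact norm_tsum_le_tsum_norm (hasSum_fintype _).summable

lemma tsum_doubleTerm (N : ℕ) (k : ℤ) (τ : ℍ) : ∑' p, doubleTerm N k τ p = -h N k τ := by
  have h' : Summable fun x ↦ doubleTerm N k τ (sigmaAntidiagonalEquivProd x) :=
    (summable_norm_doubleTerm N k τ).of_norm.comp_injective sigmaAntidiagonalEquivProd.injective
  rw [← sigmaAntidiagonalEquivProd.tsum_eq, h'.tsum_sigma, h, ← tsum_neg]
  simp only [sum_doubleTerm_divisorsAntidiagonal]

lemma hasSum_doubleTerm (N : ℕ) (k : ℤ) (τ : ℍ) : HasSum (doubleTerm N k τ) (-h N k τ) := by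
  rw [← tsum_doubleTerm]
  exact (summable_norm_doubleTerm N k τ).of_norm.hasSum

/-! ### Assembly of the rows. -/

/-- The inner sum over `d` of the twisted Eisenstein series. -/
def rowSum (τ : ℍ) (c : ℤ) : ℂ := ∑' d : ℤ, (-1 : ℂ) ^ d * secondDiff (latticePoint τ (c, d)) 1 0

lemma secondDiff_neg (w e s : ℂ) : secondDiff (-w) e s = -secondDiff w e s := by
  rw [secondDiff, secondDiff, show -w + e = -(w - e) by ring, show -w - e = -(w + e) by ring]
  simp only [heckeTerm_neg]
  ring

lemma rowSum_neg (τ : ℍ) (c : ℤ) : rowSum τ (-c) = -rowSum τ c := by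
  rw [rowSum, rowSum, ← (Equiv.neg ℤ).tsum_eq, ← tsum_neg]
  refine tsum_congr fun d ↦ ?_
  rw [Equiv.neg_apply, ← Prod.neg_mk, latticePoint_neg, secondDiff_neg, zpow_neg, ← inv_zpow]
  norm_num

lemma rowSum_natCast (τ : ℍ) (c : ℕ+) :
    rowSum τ (c : ℕ) = 8 * Real.pi * I * (qHalf τ ^ (c : ℕ) / (1 - (qHalf τ ^ (c : ℕ)) ^ 2)) := by
  have e : exp (Real.pi * I * ((c : ℕ) * τ)) = qHalf τ ^ (c : ℕ) := by
    rw [qHalf, ← exp_nat_mul]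
    congr 1
    ring
  have hs : Summable fun d : ℤ ↦ (-1 : ℂ) ^ d * secondDiff ((c : ℕ) * τ + d) 1 0 := by
    -- For N = 1 and k = 0 the character is just (-1)^d.
    refine ((summable_twist_mul_secondDiff 1 0 τ).comp_injective
      (Prod.mk_right_injective ((c : ℕ) : ℤ))).congr fun d ↦ ?_
    simp [twist, latticePoint]
  rw [← e, ← tsum_alternating_secondDiff _ hs, rowSum]
  · simp [latticePoint]
  · simpa using τ.2

lemma tsum_twist_mul_secondDiff (N : ℕ) (k : ℤ) (τ : ℍ) :
    ∑' v, twist N k v * secondDiff (latticePoint τ v) 1 0 = 8 * Real.pi * I * -h N k τ := by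
  have hs := summable_twist_mul_secondDiff N k τ
  have e (c : ℤ) : ∑' d : ℤ, twist N k (c, d) * secondDiff (latticePoint τ (c, d)) 1 0 =
      zetaN N ^ (k * c) * rowSum τ c := by
    simp only [twist, rowSum, mul_assoc, tsum_mul_left]
  have h1 := hs.prod
  simp only [e] at h1
  rw [hs.tsum_prod, tsum_congr e]
  have h0 : rowSum τ 0 = 0 := self_eq_neg.mp (by simpa using rowSum_neg τ 0)
  -- Pairing c with -c counts the row c = 0 twice, which is harmless as that row vanishes.
  have h2 := h1.hasSum.nat_add_neg
  have hf (c : ℕ+) : HasSum (fun m ↦ doubleTerm N k τ (c, m))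
      ((zetaN N ^ (k * (c : ℕ)) - zetaN N ^ (-(k * (c : ℕ)))) *
        (qHalf τ ^ (c : ℕ) / (1 - (qHalf τ ^ (c : ℕ)) ^ 2))) := by
    have hy : ‖qHalf τ ^ (c : ℕ)‖ < 1 := by
      rw [norm_pow]
      exact pow_lt_one₀ (norm_nonneg _) (norm_qHalf_lt_one τ) c.ne_zero
    refine hasSum_of_eq ((hasSum_odd_pow hy).mul_left _) (fun m ↦ ?_) rfl
    rw [doubleTerm, ← pow_mul]
  have h3 := ((hasSum_doubleTerm N k τ).prod_fiberwise hf).mul_left (8 * Real.pi * I)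
  rw [← h3.tsum_eq]
  have h4 := (hasSum_pnat_iff (f := fun n : ℕ ↦ zetaN N ^ (k * (n : ℤ)) * rowSum τ n +
    zetaN N ^ (k * -(n : ℤ)) * rowSum τ (-n))).mpr (by simpa [h0] using h2)
  rw [← h4.tsum_eq]
  refine tsum_congr fun c ↦ ?_
  rw [rowSum_neg, rowSum_natCast, mul_neg k]
  ring

/-! ### Real q and the function D_0. -/

/-- Under w ↦ 1 / w̄ the quantity w / (1 - w) becomes -1 minus its conjugate, which has the same
imaginary part. -/
lemma D0_inv_conj {w : ℂ} (hw : w ≠ 0) (hw1 : w ≠ 1) : D0 ((starRingEnd ℂ) w)⁻¹ = D0 w := by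
  have h1 : 1 - w ≠ 0 := sub_ne_zero.mpr hw1.symm
  have h2 : (starRingEnd ℂ) w ≠ 0 := by simpa using hw
  have e : ((starRingEnd ℂ) w)⁻¹ / (1 - ((starRingEnd ℂ) w)⁻¹) =
      -1 - (starRingEnd ℂ) (w / (1 - w)) := by
    have h3 : 1 - (starRingEnd ℂ) w ≠ 0 := by
      rw [← map_one (starRingEnd ℂ), ← map_sub]
      exact (map_ne_zero _).mpr h1
    have h4 : (starRingEnd ℂ) w - 1 ≠ 0 := by
      rw [← neg_sub]
      exact neg_ne_zero.mpr h3
    have h5 : 1 - ((starRingEnd ℂ) w)⁻¹ = ((starRingEnd ℂ) w - 1) / (starRingEnd ℂ) w := by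
      field_simp
    rw [h5, map_div₀, map_sub, map_one]
    field_simp
    ring
  rw [D0, D0, e, sub_im, conj_im]
  simp

lemma hasSum_pow_sub_conj {w : ℂ} (hw : ‖w‖ < 1) :
    HasSum (fun c : ℕ+ ↦ w ^ (c : ℕ) - (starRingEnd ℂ) w ^ (c : ℕ)) (2 * I * D0 w) := by
  have key {y : ℂ} (hy : ‖y‖ < 1) : HasSum (fun c : ℕ+ ↦ y ^ (c : ℕ)) (y / (1 - y)) := by
    rw [hasSum_pnat_iff_hasSum_succ (f := fun c : ℕ ↦ y ^ c)]
    simpa only [pow_succ', div_eq_mul_inv] using (hasSum_geometric_of_norm_lt_one hy).mul_left y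
  have h := (key hw).sub (key (y := (starRingEnd ℂ) w) (by simpa using hw))
  refine hasSum_of_eq h (fun _ ↦ rfl) ?_
  have e : (starRingEnd ℂ) w / (1 - (starRingEnd ℂ) w) = (starRingEnd ℂ) (w / (1 - w)) := by
    simp
  rw [e, sub_conj, D0]
  push_cast
  ring

lemma q_eq_qHalf_sq (τ : ℍ) : q τ = qHalf τ ^ 2 := by
  rw [q, qHalf, ← exp_nat_mul]
  congr 1
  push_cast
  ring

/-- A purely imaginary root would have a nonpositive square. The root may be negative; only its
reality is used later. -/
lemma qHalf_im_eq_zero {τ : ℍ} (hre : 0 < (q τ).re) (him : (q τ).im = 0) : (qHalf τ).im = 0 := by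
  rw [q_eq_qHalf_sq, sq] at hre him
  rw [mul_re] at hre
  rw [mul_im] at him
  have h : (qHalf τ).re * (qHalf τ).im = 0 := by linarith
  rcases mul_eq_zero.mp h with h | h
  · rw [h] at hre
    nlinarith [mul_self_nonneg (qHalf τ).im]
  · exact h

lemma conj_zetaN_zpow (N : ℕ) (k : ℤ) : (starRingEnd ℂ) (zetaN N ^ k) = zetaN N ^ (-k) := by
  rw [zpow_neg, inv_eq_conj (by simp [norm_zetaN])]

/-- For real `q^{1/2}`, the columns of the double series are values of `D_0`. -/
lemma hasSum_D0_nat {N : ℕ} {k : ℤ} {τ : ℍ} (h0 : (qHalf τ).im = 0) :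
    HasSum (fun j : ℕ ↦ (2 * I * D0 (zetaN N ^ k * qHalf τ ^ (2 * j + 1)) : ℂ)) (-h N k τ) := by
  have hconj : (starRingEnd ℂ) (qHalf τ) = qHalf τ := conj_eq_iff_im.mpr h0
  have hcol (m : ℕ+) : HasSum (fun c ↦ doubleTerm N k τ (c, m))
      (if Odd (m : ℕ) then (2 * I * D0 (zetaN N ^ k * qHalf τ ^ (m : ℕ)) : ℂ) else 0) := by
    split_ifs with hm
    · have hw : ‖zetaN N ^ k * qHalf τ ^ (m : ℕ)‖ < 1 := by
        rw [norm_mul, norm_zpow, norm_zetaN, one_zpow, one_mul, norm_pow]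
        exact pow_lt_one₀ (norm_nonneg _) (norm_qHalf_lt_one τ) m.ne_zero
      refine hasSum_of_eq (hasSum_pow_sub_conj hw) (fun c ↦ ?_) rfl
      rw [map_mul, map_pow, hconj, conj_zetaN_zpow, doubleTerm, if_pos hm, mul_pow, mul_pow,
        ← zpow_natCast (zetaN N ^ k), ← zpow_natCast (zetaN N ^ (-k)), ← zpow_mul, ← zpow_mul,
        neg_mul, ← pow_mul, mul_comm (m : ℕ)]
      ring
    · simp [doubleTerm, hm]
  -- Absolute convergence permits summing over c before m.
  have h1 := ((Equiv.prodComm ℕ+ ℕ+).hasSum_iff.mpr (hasSum_doubleTerm N k τ)).prod_fiberwise hcol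
  have hi : Function.Injective fun j : ℕ ↦ Nat.succPNat (2 * j) := fun i j hij ↦ by
    simpa using congrArg PNat.val hij
  rw [← hi.hasSum_iff] at h1
  · refine hasSum_of_eq h1 (fun j ↦ ?_) rfl
    simp
  · intro m hm
    refine if_neg fun ⟨j, hj⟩ ↦ hm ⟨j, PNat.eq hj.symm⟩

theorem hasSum_D0 {N : ℕ} {k : ℤ} {τ : ℍ} (h0 : (qHalf τ).im = 0) :
    HasSum (fun j : ℤ ↦ (D0 (zetaN N ^ k * qHalf τ * q τ ^ j) : ℂ)) (I * h N k τ) := by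
  have hq : qHalf τ ≠ 0 := exp_ne_zero _
  have hconj : (starRingEnd ℂ) (qHalf τ) = qHalf τ := conj_eq_iff_im.mpr h0
  have h1 := (hasSum_D0_nat (N := N) (k := k) h0).mul_left (2 * I)⁻¹
  have hI : (2 * I : ℂ) ≠ 0 := by simp
  simp only [inv_mul_cancel_left₀ hI] at h1
  have epos (j : ℕ) : zetaN N ^ k * qHalf τ * q τ ^ (j : ℤ) =
      zetaN N ^ k * qHalf τ ^ (2 * j + 1) := by
    rw [q_eq_qHalf_sq, zpow_natCast]
    ring
  have eneg (j : ℕ) : zetaN N ^ k * qHalf τ * q τ ^ (-((j : ℤ) + 1)) =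
      ((starRingEnd ℂ) (zetaN N ^ k * qHalf τ ^ (2 * j + 1)))⁻¹ := by
    rw [map_mul, map_pow, hconj, conj_zetaN_zpow, zpow_neg (zetaN N), mul_inv, inv_inv, zpow_neg,
      q_eq_qHalf_sq, mul_assoc]
    congr 1
    rw [show (j : ℤ) + 1 = ((j + 1 : ℕ) : ℤ) by push_cast; ring, zpow_natCast]
    field_simp
    ring
  have hD (j : ℕ) : D0 (zetaN N ^ k * qHalf τ * q τ ^ (-((j : ℤ) + 1))) =
      D0 (zetaN N ^ k * qHalf τ ^ (2 * j + 1)) := by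
    have hw : ‖zetaN N ^ k * qHalf τ ^ (2 * j + 1)‖ < 1 := by
      rw [norm_mul, norm_zpow, norm_zetaN, one_zpow, one_mul, norm_pow]
      exact pow_lt_one₀ (norm_nonneg _) (norm_qHalf_lt_one τ) (by omega)
    rw [eneg, D0_inv_conj]
    · exact mul_ne_zero (zpow_ne_zero _ (zetaN_ne_zero N)) (pow_ne_zero _ hq)
    · intro h
      rw [h] at hw
      simp at hw
  -- The ranges j ≥ 0 and j ≤ -1 contribute equally, so the total is 2 · (2i)⁻¹ · (-h_k) = i h_k.
  have h2 := HasSum.of_nat_of_neg_add_one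
    (f := fun j : ℤ ↦ (D0 (zetaN N ^ k * qHalf τ * q τ ^ j) : ℂ))
    (hasSum_of_eq h1 (fun j ↦ by rw [epos]) rfl) (hasSum_of_eq h1 (fun j ↦ by rw [hD]) rfl)
  refine hasSum_of_eq h2 (fun _ ↦ rfl) ?_
  rw [mul_inv, inv_I]
  ring

end

end HeckeEisenstein

theorem proposition3p5 (N : ℕ) (hN : 0 < N) (hN2 : 2 ∣ N) (k : ℤ) (τ : UpperHalfPlane) :
    -- every `G_{a,b}(τ)` is given by a genuine analytic continuation
    (∀ a b : ℤ, HeckeEisenstein.HasContinuation N (HeckeEisenstein.lattice τ)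
      (HeckeEisenstein.torsionPoint N a b τ)) ∧
    -- the series `h_k(τ)` converges absolutely
    Summable (fun n : ℕ+ => ‖HeckeEisenstein.hTerm N k τ n‖) ∧
    -- the identity
    1 / (2 * (Real.pi : ℂ) * Complex.I) *
        ∑ a ∈ Finset.range N, ∑ b ∈ Finset.range N,
          HeckeEisenstein.zetaN N ^ (k * (a : ℤ)) * (-1) ^ b *
            HeckeEisenstein.Gab N (a : ℤ) (b : ℤ) τ
      = HeckeEisenstein.h N k τ ∧
    -- if `q` is real and positive, then `h_k(τ) = (1 / i) D_{0,q}(ζ_N^k q^{1/2})`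
    (0 < (HeckeEisenstein.q τ).re → (HeckeEisenstein.q τ).im = 0 →
      Summable (fun j : ℤ => HeckeEisenstein.D0
        (HeckeEisenstein.zetaN N ^ k * HeckeEisenstein.qHalf τ * HeckeEisenstein.q τ ^ j)) ∧
      HeckeEisenstein.h N k τ = 1 / Complex.I *
        (HeckeEisenstein.D0q (HeckeEisenstein.q τ)
          (HeckeEisenstein.zetaN N ^ k * HeckeEisenstein.qHalf τ) : ℂ)) := by
  refine ⟨fun a b ↦ ?_, HeckeEisenstein.summable_norm_hTerm N k τ, ?_, fun hre him ↦ ?_⟩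
  · obtain ⟨F, hF, -⟩ := HeckeEisenstein.exists_isContinuation hN τ a b
    exact ⟨F, -1, by norm_num, hF⟩
  · have h := HeckeEisenstein.sum_twist_mul_Gab hN hN2 k τ
    rw [HeckeEisenstein.tsum_twist_mul_secondDiff] at h
    simp only [HeckeEisenstein.twist, zpow_natCast (-1 : ℂ)] at h
    -- The constants combine to (-1/4) · 8πi · (-h_k) = 2πi h_k.
    rw [h]
    have hpi : (Real.pi : ℂ) ≠ 0 := by exact_mod_cast Real.pi_ne_zero
    have hI := Complex.I_ne_zero
    field_simp
    ring
  · have h := HeckeEisenstein.hasSum_D0 (N := N) (k := k)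
      (HeckeEisenstein.qHalf_im_eq_zero hre him)
    have hs := Complex.summable_ofReal.mp h.summable
    refine ⟨hs, ?_⟩
    rw [HeckeEisenstein.D0q, Complex.ofReal_tsum, h.tsum_eq, one_div,
      inv_mul_cancel_left₀ Complex.I_ne_zero]
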